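/- Let $d,q\ge 0$ be integers, let $\Theta\subset\mathbb R\times\mathbb R^d\times\mathbb R^q$ be compact, let $\mathcal X\subset\mathbb R^d$ be bounded, and let $\mu$ be a probability measure on $\mathbb R^d$ concentrated on $\mathcal X$. Put $\Theta_\eta:=\{\eta:(\beta_0,\beta_1,\eta)\in\Theta\text{ for some }\beta_0,\beta_1\}$. Let $h:\mathbb R^d\times\mathbb R^q\to\mathbb R$ be an expert function such that $h(\cdot,\eta)$ is measurable for every $\eta\in\Theta_\eta$, and such that for some constants $M,L$, all $x\in\mathcal X$ and all $\eta,\eta'\in\Theta_\eta$ we have $|h(x,\eta)|\le M$ and $|h(x,\eta)-h(x,\eta')|\le L\|\eta-\eta'\|$. For a mixing measure $G=\sum_{i=1}^{m}\exp(\beta_{0i})\,\delta_{(\beta_{1i},\eta_i)}$ with $m\ge 1$ components put $$f_G(x):=\sum_{i=1}^{m}\frac{\exp(\beta_{1i}^\top x+\beta_{0i})}{\sum_{j=1}^{m}\exp(\beta_{1j}^\top x+\beta_{0j})}\,h(x,\eta_i),$$ and let $$\mathcal G_k(\Theta):=\Big\{\sum_{i=1}^{m}\exp(\beta_{0i})\delta_{(\beta_{1i},\eta_i)}:\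 1\le m\le k,\ (\beta_{0i},\beta_{1i},\eta_i)\in\Theta\Big\}.$$ Let $G_*=\sum_{i=1}^{k_*}\exp(\beta^*_{0i})\delta_{(\beta^*_{1i},\eta^*_i)}$ with $(\beta^*_{0i},\beta^*_{1i},\eta^*_i)\in\Theta$ for all $i$, where $k_*\le k$, the parameters $\eta^*_1,\dots,\eta^*_{k_*}$ are pairwise distinct, $\beta^*_{0k_*}=0$, $\beta^*_{1k_*}=0$, and at least one of $\beta^*_{11},\dots,\beta^*_{1k_*}$ is non-zero. Let $(X_1,\varepsilon_1),(X_2,\varepsilon_2),\dots$ be independent pairs on a probability space such that, for every $i$, $X_i$ has law $\mu$ and, conditionally on $X_i$, the noise $\varepsilon_i$ is Gaussian with mean $0$ and variance $\nu$ (that is, $\varepsilon_i$ has law $\mathcal N(0,\nu)$ and is independent of $X_i$), and let $Y_i=f_{G_*}(X_i)+\varepsilon_i$. For each $n$ let $\widehat G_n$ be a least squares estimator, that is, almost surely $\widehat G_n$ minimizes $\sum_{i=1}^n (Y_i-f_G(X_i))^2$ over $G\in\mathcal G_k(\Theta)$. Then $$\|f_{\widehat G_n}-f_{G_*}\|_{L^2(\mu)}=\mathcal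 O_P\big(\sqrt{\log(n)/n}\big),$$ that is, for every $\epsilon>0$ there are $C>0$ and $N$ such that $\mathbb P\big(\|f_{\widehat G_n}-f_{G_*}\|_{L^2(\mu)}>C\sqrt{\log(n)/n}\big)\le\epsilon$ for all $n\ge N$. -/

import Mathlib

open MeasureTheory ProbabilityTheory Filter
open scoped NNReal ENNReal

noncomputable section

/-- The space `ℝ × ℝ^d × ℝ^q` of parameters `(β₀, β₁, η)` of one component of the model. -/
abbrev MoEParam (d q : ℕ) : Type :=
  ℝ × EuclideanSpace ℝ (Fin d) × EuclideanSpace ℝ (Fin q)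

/-- The space `ℝ^d × ℝ^q` of atoms `(β₁, η)` of a mixing measure. -/
abbrev MoEAtom (d q : ℕ) : Type :=
  EuclideanSpace ℝ (Fin d) × EuclideanSpace ℝ (Fin q)

/-- The mixing measure `∑ᵢ exp(β₀ᵢ) δ_(β₁ᵢ, ηᵢ)` with component parameters
`θ i = (β₀ᵢ, β₁ᵢ, ηᵢ)`. -/
def mixingMeasure {d q m : ℕ} (θ : Fin m → MoEParam d q) : Measure (MoEAtom d q) :=
  ∑ i, ENNReal.ofReal (Real.exp (θ i).1) • Measure.dirac (θ i).2

/-- The set `𝒢ₖ(Θ)` of all mixing measures with at least one and at most `k` components,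
all of whose component parameters lie in `Θ`. -/
def mixingMeasures {d q : ℕ} (k : ℕ) (Θ : Set (MoEParam d q)) : Set (Measure (MoEAtom d q)) :=
  {G | ∃ m : ℕ, 1 ≤ m ∧ m ≤ k ∧
    ∃ θ : Fin m → MoEParam d q, (∀ i, θ i ∈ Θ) ∧ G = mixingMeasure θ}

/-- The softmax gating mixture of experts regression function
`f_G(x) = ∫ exp(β₁ᵀx) h(x, η) dG(β₁, η) / ∫ exp(β₁ᵀx) dG(β₁, η)` of a mixing measure `G`, for the
expert function `h`. For `G = ∑ᵢ exp(β₀ᵢ) δ_(β₁ᵢ, ηᵢ)` this is the usual finite softmax mixture,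
see `moeRegression_mixingMeasure`. -/
def moeRegression {d q : ℕ} (h : EuclideanSpace ℝ (Fin d) → EuclideanSpace ℝ (Fin q) → ℝ)
    (G : Measure (MoEAtom d q)) (x : EuclideanSpace ℝ (Fin d)) : ℝ :=
  (∫ w, Real.exp (inner ℝ w.1 x) * h x w.2 ∂G) / ∫ w, Real.exp (inner ℝ w.1 x) ∂G

theorem integral_mixingMeasure {d q m : ℕ} (θ : Fin m → MoEParam d q) (g : MoEAtom d q → ℝ) :
    ∫ w, g w ∂(mixingMeasure θ) = ∑ i, Real.exp (θ i).1 * g (θ i).2 := by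
  unfold mixingMeasure
  rw [integral_finsetSum_measure]
  · refine Finset.sum_congr rfl fun i _ => ?_
    rw [integral_smul_measure, integral_dirac, ENNReal.toReal_ofReal (Real.exp_pos _).le,
      smul_eq_mul]
  · intro i _
    exact (integrable_dirac (by simp)).smul_measure ENNReal.ofReal_ne_top

theorem moeRegression_mixingMeasure {d q m : ℕ}
    (h : EuclideanSpace ℝ (Fin d) → EuclideanSpace ℝ (Fin q) → ℝ)
    (θ : Fin m → MoEParam d q) (x : EuclideanSpace ℝ (Fin d)) :
    moeRegression h (mixingMeasure θ) x =
      ∑ i, Real.exp (inner ℝ (θ i).2.1 x + (θ i).1) /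
        (∑ j, Real.exp (inner ℝ (θ j).2.1 x + (θ j).1)) * h x (θ i).2.2 := by
  unfold moeRegression
  rw [integral_mixingMeasure, integral_mixingMeasure, Finset.sum_div]
  simp only [Real.exp_add]
  refine Finset.sum_congr rfl fun i _ => ?_
  rw [show (∑ j, Real.exp (θ j).1 * Real.exp (inner ℝ (θ j).2.1 x)) =
    ∑ j, Real.exp (inner ℝ (θ j).2.1 x) * Real.exp (θ j).1 from
    Finset.sum_congr rfl fun j _ => mul_comm _ _]
  ring

/-- `G` is a least squares estimator over `𝒢ₖ(Θ)` for the data `(x₁, y₁), …, (xₙ, yₙ)`: it is a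
minimizer over `𝒢ₖ(Θ)` of the residual sum of squares. -/
def IsLeastSquaresEstimator {d q n : ℕ}
    (h : EuclideanSpace ℝ (Fin d) → EuclideanSpace ℝ (Fin q) → ℝ)
    (k : ℕ) (Θ : Set (MoEParam d q))
    (x : Fin n → EuclideanSpace ℝ (Fin d)) (y : Fin n → ℝ) (G : Measure (MoEAtom d q)) : Prop :=
  G ∈ mixingMeasures k Θ ∧
    IsMinOn (fun G' => ∑ i, (y i - moeRegression h G' (x i)) ^ 2) (mixingMeasures k Θ) G

/-- `Zₙ = O_P(bₙ)`: the sequence `Zₙ / bₙ` is stochastically bounded, for `[0, ∞]`-valued `Zₙ` and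
eventually positive `bₙ`. (On a non-measurable event, `P` is the outer probability.) -/
def IsBigOInProbability {Ω : Type*} [MeasurableSpace Ω] (P : Measure Ω)
    (Z : ℕ → Ω → ℝ≥0∞) (b : ℕ → ℝ) : Prop :=
  ∀ ε : ℝ, 0 < ε → ∃ C : ℝ, 0 < C ∧
    ∀ᶠ n in atTop, P {ω | ENNReal.ofReal (C * b n) < Z n ω} ≤ ENNReal.ofReal ε

end

/-! The rate comes from a union bound over a finite net; no chaining or localisation is needed.
Softmax averages are Lipschitz in their parameters (`abs_softmax_average_sub_le`), so the regression
functions have sup-norm nets of radius `1/n` with at most `A * n ^ a` elements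
(`exists_finset_cover_moeRegression`). For a fixed `g`, integrating out the Gaussian noise shows
that the sum of `2 ε (g - f₀) - (g - f₀) ^ 2` over the sample exceeds a constant `-s` with
probability at most `exp (t * s) * exp (-(t / 4) * n * ‖g - f₀‖²)` (`measureReal_excess_loss_le`).
If `‖g - f₀‖² ≥ D² log n / n` with `D` large, this is `O(n ^ -(a + 1))`, and summing over the net
leaves `O(1/n)`. The sum is nonnegative at the minimizer, and passing to a net point within `1/n`
costs only a constant when `∑ |ε i| ≤ K * n` (`neg_le_sum_excess_loss_of_isMin`). Hence, with high
probability, that net point is not far from `f₀`, and neither is the estimator. -/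

/-! ### Covering numbers in finite dimension -/

/-- In a finite-dimensional normed space, the ball of radius `R` is covered by `N ^ j` balls of
radius `R / 2 ^ j`. -/
theorem exists_finset_cover_closedBall {E : Type*} [NormedAddCommGroup E] [NormedSpace ℝ E]
    [FiniteDimensional ℝ E] :
    ∃ N : ℕ, ∀ R : ℝ, 0 < R → ∀ j : ℕ, ∃ T : Finset E, T.card ≤ N ^ j ∧
      ∀ x : E, ‖x‖ ≤ R → ∃ y ∈ T, dist x y ≤ R / 2 ^ j := by
  classical
  have : ProperSpace E := FiniteDimensional.proper ℝ E
  obtain ⟨S, -, hS_fin, hS⟩ := (isCompact_closedBall (0 : E) 1).finite_cover_balls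
    (show (0 : ℝ) < 1 / 2 by norm_num)
  refine ⟨hS_fin.toFinset.card, fun R hR j => ?_⟩
  induction j with
  | zero => exact ⟨{0}, by simp, fun x hx => ⟨0, by simp, by simpa using hx⟩⟩
  | succ j ih =>
    obtain ⟨T, hT, hcov⟩ := ih
    refine ⟨(T ×ˢ hS_fin.toFinset).image fun p => p.1 + (R / 2 ^ j) • p.2, ?_, fun x hx => ?_⟩
    · refine Finset.card_image_le.trans ?_
      rw [Finset.card_product, pow_succ]
      exact Nat.mul_le_mul_right _ hT
    · obtain ⟨c, hc, hxc⟩ := hcov x hx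
      have hr : 0 < R / 2 ^ j := by positivity
      have hmem : (R / 2 ^ j)⁻¹ • (x - c) ∈ Metric.closedBall (0 : E) 1 := by
        rw [mem_closedBall_zero_iff, norm_smul, norm_inv, Real.norm_of_nonneg hr.le,
          ← dist_eq_norm, inv_mul_le_iff₀ hr]
        simpa using hxc
      obtain ⟨s, hs, hxs⟩ := Set.mem_iUnion₂.1 (hS hmem)
      refine ⟨c + (R / 2 ^ j) • s, Finset.mem_image.2 ⟨(c, s), by simpa using ⟨hc, hs⟩, rfl⟩, ?_⟩
      have hx : x - (c + (R / 2 ^ j) • s) = (R / 2 ^ j) • ((R / 2 ^ j)⁻¹ • (x - c) - s) := by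
        rw [smul_sub, smul_inv_smul₀ hr.ne']
        abel
      rw [dist_eq_norm, hx, norm_smul, Real.norm_of_nonneg hr.le, ← dist_eq_norm, pow_succ,
        ← div_div, div_eq_mul_one_div (R / 2 ^ j) 2]
      exact mul_le_mul_of_nonneg_left (Metric.mem_ball.1 hxs).le hr.le

/-- A bounded set in a finite-dimensional normed space has internal covering numbers of polynomial
growth. -/
theorem Bornology.IsBounded.exists_finset_cover_polynomial {E : Type*} [NormedAddCommGroup E]
    [NormedSpace ℝ E] [FiniteDimensional ℝ E] {K : Set E} (hK : Bornology.IsBounded K) :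
    ∃ A a : ℕ, ∀ n : ℕ, 1 ≤ n → ∃ T : Finset E, ↑T ⊆ K ∧ T.card ≤ A * n ^ a ∧
      ∀ x ∈ K, ∃ y ∈ T, dist x y ≤ 1 / n := by
  classical
  obtain ⟨N, hN⟩ := exists_finset_cover_closedBall (E := E)
  obtain ⟨r, hr⟩ := hK.exists_norm_le
  obtain ⟨R, hR⟩ := exists_nat_ge (max r 1)
  have hR1 : 1 ≤ R := by exact_mod_cast (le_max_right r 1).trans hR
  refine ⟨(4 * R) ^ N, N, fun n hn => ?_⟩
  -- The least `j` with `2 ^ j ≥ 2 * R * n`: the radius `R / 2 ^ j` is at most `1 / (2 * n)`, while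
  -- minimality keeps `N ^ j` polynomial in `n`.
  obtain ⟨T, hT, hcov⟩ := hN R (by positivity) (Nat.clog 2 (2 * R * n))
  have hlarge : 2 * R * n ≤ 2 ^ Nat.clog 2 (2 * R * n) := Nat.le_pow_clog (by norm_num) _
  have hsmall : 2 ^ Nat.clog 2 (2 * R * n) ≤ 4 * R * n := by
    have h1 : 1 < 2 * R * n := by nlinarith
    have h2 := Nat.pow_pred_clog_lt_self (b := 2) (by norm_num) h1
    have h3 : Nat.clog 2 (2 * R * n) = (Nat.clog 2 (2 * R * n)).pred + 1 :=
      (Nat.succ_pred (Nat.clog_pos (by norm_num) h1).ne').symm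
    rw [h3, pow_succ]
    nlinarith
  -- Moving each useful centre to a nearby point of `K` makes the net internal and doubles the
  -- radius.
  choose! p hp using fun (c : E) (hc : ∃ x ∈ K, dist x c ≤ R / 2 ^ Nat.clog 2 (2 * R * n)) => hc
  refine ⟨(T.filter fun c => ∃ x ∈ K, dist x c ≤ R / 2 ^ Nat.clog 2 (2 * R * n)).image p,
    ?_, ?_, fun x hx => ?_⟩
  · intro y hy
    obtain ⟨c, hc, rfl⟩ := Finset.mem_image.1 (Finset.mem_coe.1 hy)
    exact (hp c (Finset.mem_filter.1 hc).2).1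
  · refine Finset.card_image_le.trans ((Finset.card_filter_le _ _).trans (hT.trans ?_))
    calc N ^ Nat.clog 2 (2 * R * n) ≤ (2 ^ N) ^ Nat.clog 2 (2 * R * n) :=
          Nat.pow_le_pow_left Nat.lt_two_pow_self.le _
      _ = (2 ^ Nat.clog 2 (2 * R * n)) ^ N := by rw [← pow_mul, ← pow_mul, mul_comm]
      _ ≤ (4 * R * n) ^ N := Nat.pow_le_pow_left hsmall _
      _ = (4 * R) ^ N * n ^ N := mul_pow _ _ _
  · obtain ⟨c, hc, hxc⟩ := hcov x ((hr x hx).trans ((le_max_left r 1).trans hR))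
    have hex : ∃ x ∈ K, dist x c ≤ R / 2 ^ Nat.clog 2 (2 * R * n) := ⟨x, hx, hxc⟩
    refine ⟨p c, Finset.mem_image_of_mem _ (Finset.mem_filter.2 ⟨hc, hex⟩), ?_⟩
    have hn' : (0 : ℝ) < n := by exact_mod_cast hn
    have hlarge' : 2 * (R : ℝ) * n ≤ 2 ^ Nat.clog 2 (2 * R * n) := by exact_mod_cast hlarge
    calc dist x (p c) ≤ dist x c + dist (p c) c := dist_triangle_right _ _ _
      _ ≤ R / 2 ^ Nat.clog 2 (2 * R * n) + R / 2 ^ Nat.clog 2 (2 * R * n) :=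
          add_le_add hxc (hp c hex).2
      _ ≤ 1 / n := by
          rw [← add_div, div_le_div_iff₀ (by positivity) hn']
          linarith

/-! ### Lipschitz dependence of softmax mixtures on their parameters -/

/-- Softmax averages are Lipschitz in their logits and values. -/
theorem abs_softmax_average_sub_le {ι : Type*} [Fintype ι] [Nonempty ι] {u u' v v' : ι → ℝ}
    {M s t : ℝ} (hs : ∀ i, |u i - u' i| ≤ s) (ht : ∀ i, |v i - v' i| ≤ t)
    (hv : ∀ i, |v i| ≤ M) (hv' : ∀ i, |v' i| ≤ M) :
    |∑ i, Real.exp (u i) / (∑ j, Real.exp (u j)) * v i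
      - ∑ i, Real.exp (u' i) / (∑ j, Real.exp (u' j)) * v' i| ≤ t + 4 * M * s := by
  have avg_le : ∀ (w z : ι → ℝ) (C : ℝ), (∀ i, |z i| ≤ C) →
      |∑ i, Real.exp (w i) / (∑ j, Real.exp (w j)) * z i| ≤ C := by
    intro w z C hz
    have hD : 0 < ∑ j, Real.exp (w j) :=
      Finset.sum_pos (fun i _ => Real.exp_pos _) Finset.univ_nonempty
    calc _ ≤ ∑ i, |Real.exp (w i) / (∑ j, Real.exp (w j)) * z i| :=
          Finset.abs_sum_le_sum_abs _ _
      _ ≤ ∑ i, Real.exp (w i) / (∑ j, Real.exp (w j)) * C := by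
          refine Finset.sum_le_sum fun i _ => ?_
          rw [abs_mul, abs_of_pos (div_pos (Real.exp_pos _) hD)]
          exact mul_le_mul_of_nonneg_left (hz i) (div_pos (Real.exp_pos _) hD).le
      _ = C := by
          rw [← Finset.sum_mul, ← Finset.sum_div, div_self hD.ne', one_mul]
  have hM : 0 ≤ M := (abs_nonneg _).trans (hv (Classical.arbitrary ι))
  have ht0 : 0 ≤ t := (abs_nonneg _).trans (ht (Classical.arbitrary ι))
  have hs0 : 0 ≤ s := (abs_nonneg _).trans (hs (Classical.arbitrary ι))
  have hf := avg_le u v M hv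
  have hf' := avg_le u' v' M hv'
  set D := ∑ j, Real.exp (u j) with hDdef
  set D' := ∑ j, Real.exp (u' j) with hDdef'
  set f' := ∑ i, Real.exp (u' i) / D' * v' i with hf'def
  -- For `s > 1` the trivial bound `2 * M` suffices.
  rcases le_or_gt s 1 with hs1 | hs1
  · have hD : 0 < D := Finset.sum_pos (fun i _ => Real.exp_pos _) Finset.univ_nonempty
    have hD' : 0 < D' := Finset.sum_pos (fun i _ => Real.exp_pos _) Finset.univ_nonempty
    -- Values centred at their average `f'` have zero weighted sum. Subtracting this zero turns the
    -- difference into one softmax average with weights `u`, so the change of normaliser need not be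
    -- estimated.
    have hcenter : ∑ i, Real.exp (u' i) * (v' i - f') = 0 := by
      simp only [mul_sub, Finset.sum_sub_distrib, ← Finset.sum_mul]
      rw [← hDdef', hf'def, Finset.mul_sum, sub_eq_zero]
      exact Finset.sum_congr rfl fun i _ => by field_simp
    have hsplit : ∑ i, Real.exp (u i) / D * v i - f' =
        ∑ i, Real.exp (u i) / D * ((v i - v' i) + (1 - Real.exp (u' i - u i)) * (v' i - f')) := by
      have h1 : ∀ i, Real.exp (u i) / D *
          ((v i - v' i) + (1 - Real.exp (u' i - u i)) * (v' i - f')) =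
          Real.exp (u i) / D * v i - Real.exp (u i) / D * f'
            - (Real.exp (u' i) * (v' i - f')) / D := by
        intro i
        rw [Real.exp_sub]
        field_simp
        ring
      simp only [h1, Finset.sum_sub_distrib, ← Finset.sum_mul, ← Finset.sum_div]
      rw [hcenter, ← hDdef, div_self hD.ne']
      ring
    rw [hsplit]
    refine avg_le u _ _ fun i => ?_
    have hexp : |1 - Real.exp (u' i - u i)| ≤ 2 * s := by
      have h2 : |u' i - u i| ≤ s := by rw [abs_sub_comm]; exact hs i
      rw [abs_sub_comm]
      exact (Real.abs_exp_sub_one_le (h2.trans hs1)).trans (by linarith)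
    have hdiff : |v' i - f'| ≤ 2 * M := (abs_sub _ _).trans (by linarith [hv' i])
    calc _ ≤ |v i - v' i| + |(1 - Real.exp (u' i - u i)) * (v' i - f')| := abs_add_le _ _
      _ ≤ t + 2 * s * (2 * M) := by
          rw [abs_mul]
          exact add_le_add (ht i) (mul_le_mul hexp hdiff (abs_nonneg _) (by linarith))
      _ = t + 4 * M * s := by ring
  · calc _ ≤ _ := abs_sub _ _
      _ ≤ t + 4 * M * s := by nlinarith

section MoE

variable {d q : ℕ}

theorem measurable_moeRegression {m : ℕ} {Θ : Set (MoEParam d q)}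
    {h : EuclideanSpace ℝ (Fin d) → EuclideanSpace ℝ (Fin q) → ℝ}
    (h_meas : ∀ θ ∈ Θ, Measurable fun x => h x θ.2.2)
    {θ : Fin m → MoEParam d q} (hθ : ∀ i, θ i ∈ Θ) :
    Measurable (moeRegression h (mixingMeasure θ)) := by
  have heq : moeRegression h (mixingMeasure θ) = fun x =>
      ∑ i, Real.exp (inner ℝ (θ i).2.1 x + (θ i).1) /
        (∑ j, Real.exp (inner ℝ (θ j).2.1 x + (θ j).1)) * h x (θ i).2.2 :=
    funext fun x => moeRegression_mixingMeasure h θ x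
  rw [heq]
  have := fun i => h_meas (θ i) (hθ i)
  fun_prop

/-- Logits are affine in `(β₀, β₁)`, with slopes `1` and `x`, so they move by at most `(r + 1) *
dist θ θ'`; the expert values move by at most `L * dist θ θ'`. -/
theorem abs_moeRegression_sub_le {m : ℕ} (hm : 1 ≤ m) {Θ : Set (MoEParam d q)}
    {h : EuclideanSpace ℝ (Fin d) → EuclideanSpace ℝ (Fin q) → ℝ} {M L r : ℝ} (hL : 0 ≤ L)
    {x : EuclideanSpace ℝ (Fin d)} (hx : ‖x‖ ≤ r) (h_bdd : ∀ θ ∈ Θ, |h x θ.2.2| ≤ M)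
    (h_lip : ∀ θ ∈ Θ, ∀ θ' ∈ Θ, |h x θ.2.2 - h x θ'.2.2| ≤ L * ‖θ.2.2 - θ'.2.2‖)
    {θ θ' : Fin m → MoEParam d q} (hθ : ∀ i, θ i ∈ Θ) (hθ' : ∀ i, θ' i ∈ Θ) :
    |moeRegression h (mixingMeasure θ) x - moeRegression h (mixingMeasure θ') x|
      ≤ (L + 4 * M * (r + 1)) * dist θ θ' := by
  have : Nonempty (Fin m) := ⟨⟨0, hm⟩⟩
  have hdist : ∀ i, ‖θ i - θ' i‖ ≤ dist θ θ' := fun i => by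
    rw [← dist_eq_norm]
    exact dist_le_pi_dist θ θ' i
  rw [moeRegression_mixingMeasure, moeRegression_mixingMeasure]
  have key := abs_softmax_average_sub_le (M := M) (s := (r + 1) * dist θ θ')
    (t := L * dist θ θ')
    (u := fun i => inner ℝ (θ i).2.1 x + (θ i).1) (u' := fun i => inner ℝ (θ' i).2.1 x + (θ' i).1)
    (v := fun i => h x (θ i).2.2) (v' := fun i => h x (θ' i).2.2) ?_ ?_
    (fun i => h_bdd _ (hθ i)) (fun i => h_bdd _ (hθ' i))
  · calc _ ≤ _ := key
      _ = _ := by ring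
  · intro i
    have h0 : |(θ i).1 - (θ' i).1| ≤ dist θ θ' := (norm_fst_le (θ i - θ' i)).trans (hdist i)
    have h1 : ‖(θ i).2.1 - (θ' i).2.1‖ ≤ dist θ θ' :=
      (norm_fst_le (θ i - θ' i).2).trans ((norm_snd_le (θ i - θ' i)).trans (hdist i))
    have h2 : |inner ℝ ((θ i).2.1 - (θ' i).2.1) x| ≤ dist θ θ' * r :=
      (abs_real_inner_le_norm _ _).trans (mul_le_mul h1 hx (norm_nonneg _) dist_nonneg)
    rw [inner_sub_left] at h2
    calc _ = |(inner ℝ (θ i).2.1 x - inner ℝ (θ' i).2.1 x) + ((θ i).1 - (θ' i).1)| := by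
          congr 1; ring
      _ ≤ _ := (abs_add_le _ _).trans (add_le_add h2 h0)
      _ = _ := by ring
  · intro i
    have h1 : ‖(θ i).2.2 - (θ' i).2.2‖ ≤ dist θ θ' :=
      (norm_snd_le (θ i - θ' i).2).trans ((norm_snd_le (θ i - θ' i)).trans (hdist i))
    exact (h_lip _ (hθ i) _ (hθ' i)).trans (mul_le_mul_of_nonneg_left h1 hL)

theorem abs_moeRegression_le {m : ℕ} (hm : 1 ≤ m) {Θ : Set (MoEParam d q)}
    {h : EuclideanSpace ℝ (Fin d) → EuclideanSpace ℝ (Fin q) → ℝ} {M : ℝ}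
    {x : EuclideanSpace ℝ (Fin d)} (h_bdd : ∀ θ ∈ Θ, |h x θ.2.2| ≤ M)
    {θ : Fin m → MoEParam d q} (hθ : ∀ i, θ i ∈ Θ) :
    |moeRegression h (mixingMeasure θ) x| ≤ M := by
  have : Nonempty (Fin m) := ⟨⟨0, hm⟩⟩
  have hD : 0 < ∑ j, Real.exp (inner ℝ (θ j).2.1 x + (θ j).1) :=
    Finset.sum_pos (fun i _ => Real.exp_pos _) Finset.univ_nonempty
  rw [moeRegression_mixingMeasure]
  refine (Finset.abs_sum_le_sum_abs _ _).trans ?_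
  calc _ ≤ ∑ i, Real.exp (inner ℝ (θ i).2.1 x + (θ i).1) /
        (∑ j, Real.exp (inner ℝ (θ j).2.1 x + (θ j).1)) * M := by
        refine Finset.sum_le_sum fun i _ => ?_
        rw [abs_mul, abs_of_pos (div_pos (Real.exp_pos _) hD)]
        exact mul_le_mul_of_nonneg_left (h_bdd _ (hθ i)) (div_pos (Real.exp_pos _) hD).le
    _ = M := by rw [← Finset.sum_mul, ← Finset.sum_div, div_self hD.ne', one_mul]

/-- The softmax mixtures with at most `k` components have sup-norm covering numbers of polynomial
growth. -/
theorem exists_finset_cover_moeRegression (k : ℕ) {Θ : Set (MoEParam d q)} (hΘ : IsCompact Θ)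
    {𝒳 : Set (EuclideanSpace ℝ (Fin d))} (h𝒳 : Bornology.IsBounded 𝒳)
    {h : EuclideanSpace ℝ (Fin d) → EuclideanSpace ℝ (Fin q) → ℝ}
    (h_bdd : ∃ M : ℝ, ∀ x ∈ 𝒳, ∀ θ ∈ Θ, |h x θ.2.2| ≤ M)
    (h_lip : ∃ L : ℝ, ∀ x ∈ 𝒳, ∀ θ ∈ Θ, ∀ θ' ∈ Θ,
      |h x θ.2.2 - h x θ'.2.2| ≤ L * ‖θ.2.2 - θ'.2.2‖) :
    ∃ A a : ℕ, ∀ n : ℕ, 1 ≤ n → ∃ T : Finset (EuclideanSpace ℝ (Fin d) → ℝ),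
      ↑T ⊆ moeRegression h '' mixingMeasures k Θ ∧ T.card ≤ A * n ^ a ∧
      ∀ f ∈ moeRegression h '' mixingMeasures k Θ, ∃ g ∈ T, ∀ x ∈ 𝒳, |f x - g x| ≤ 1 / n := by
  classical
  obtain ⟨M, hM⟩ := h_bdd
  obtain ⟨L, hL⟩ := h_lip
  obtain ⟨r, hr⟩ := h𝒳.exists_norm_le
  -- `c` dominates the Lipschitz constant, so a parameter net of radius `1 / (c * n)` suffices.
  obtain ⟨c, hc⟩ := exists_nat_ge (max (|L| + 4 * M * (r + 1)) 1)
  have hc1 : 1 ≤ c := by exact_mod_cast (le_max_right _ _).trans hc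
  have hcov := fun m : ℕ => ((isCompact_univ_pi fun _ : Fin m => hΘ).isBounded
    ).exists_finset_cover_polynomial
  choose A a hA using hcov
  refine ⟨∑ m ∈ Finset.Icc 1 k, A m * c ^ a m, ∑ m ∈ Finset.Icc 1 k, a m, fun n hn => ?_⟩
  choose T hTsub hTcard hT using fun m => hA m (c * n) (Nat.mul_pos hc1 hn)
  refine ⟨(Finset.Icc 1 k).biUnion fun m =>
    (T m).image fun θ => moeRegression h (mixingMeasure θ), ?_, ?_, ?_⟩
  · intro f hf
    obtain ⟨m, hm, hf⟩ := Finset.mem_biUnion.1 (Finset.mem_coe.1 hf)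
    obtain ⟨θ, hθ, rfl⟩ := Finset.mem_image.1 hf
    rw [Finset.mem_Icc] at hm
    exact ⟨_, ⟨m, hm.1, hm.2, θ, fun i => hTsub m hθ i (Set.mem_univ i), rfl⟩, rfl⟩
  · refine Finset.card_biUnion_le.trans ?_
    rw [Finset.sum_mul]
    refine Finset.sum_le_sum fun m hm => Finset.card_image_le.trans ((hTcard m).trans ?_)
    rw [mul_pow, ← mul_assoc]
    exact Nat.mul_le_mul_left _ (Nat.pow_le_pow_right hn
      (Finset.single_le_sum (f := a) (fun _ _ => Nat.zero_le _) hm))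
  · rintro _ ⟨_, ⟨m, hm, hmk, θ, hθ, rfl⟩, rfl⟩
    obtain ⟨θ', hθ'T, hdist⟩ := hT m θ fun i _ => hθ i
    refine ⟨_, Finset.mem_biUnion.2 ⟨m, Finset.mem_Icc.2 ⟨hm, hmk⟩,
      Finset.mem_image_of_mem _ hθ'T⟩, fun x hx => ?_⟩
    have hlip := abs_moeRegression_sub_le hm (abs_nonneg L) (hr x hx) (hM x hx)
      (fun θ hθ θ' hθ' => (hL x hx θ hθ θ' hθ').trans
        (mul_le_mul_of_nonneg_right (le_abs_self L) (norm_nonneg _)))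
      hθ (fun i => hTsub m hθ'T i (Set.mem_univ i))
    have hn' : (0 : ℝ) < n := by exact_mod_cast hn
    have hc' : (0 : ℝ) < c := by exact_mod_cast hc1
    calc _ ≤ _ := hlip
      _ ≤ c * (1 / (c * n : ℕ)) :=
          mul_le_mul ((le_max_left _ _).trans hc) hdist dist_nonneg hc'.le
      _ = 1 / n := by push_cast; field_simp

end MoE

/-! ### Exponential moments and deviation of the excess loss -/

/-- On `[0, 1]`, `exp (-u) ≤ 1 / (1 + u) ≤ 1 - u / 2`. -/
theorem exp_neg_le_one_sub_half {u : ℝ} (hu0 : 0 ≤ u) (hu1 : u ≤ 1) :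
    Real.exp (-u) ≤ 1 - u / 2 := by
  have h1 : u + 1 ≤ Real.exp u := Real.add_one_le_exp u
  have h2 : Real.exp (-u) * Real.exp u = 1 := by rw [← Real.exp_add]; simp
  have h3 := mul_le_mul_of_nonneg_left h1 (Real.exp_pos (-u)).le
  by_contra! h4
  nlinarith

section ExcessLoss

variable {α Ω : Type*} [MeasurableSpace α] [MeasurableSpace Ω] {μ : Measure α}
  [IsProbabilityMeasure μ] {P : Measure Ω} [IsProbabilityMeasure P] {ν : ℝ≥0}

theorem integrable_exp_excess_loss {g : α → ℝ} (hg : Measurable g) {B : ℝ}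
    (hgB : ∀ᵐ x ∂μ, |g x| ≤ B) {t : ℝ} (ht : 0 ≤ t) :
    Integrable (fun p : α × ℝ => Real.exp (t * (2 * p.2 * g p.1 - g p.1 ^ 2)))
      (μ.prod (gaussianReal 0 ν)) := by
  have hdom : Integrable (fun p : α × ℝ =>
      Real.exp ((2 * t * B) * p.2) + Real.exp (-(2 * t * B) * p.2))
      (μ.prod (gaussianReal 0 ν)) :=
    ((integrable_exp_mul_gaussianReal (2 * t * B)).add
      (integrable_exp_mul_gaussianReal (-(2 * t * B)))).comp_snd μ
  refine hdom.mono' (by fun_prop) ?_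
  filter_upwards [Measure.quasiMeasurePreserving_fst.ae hgB] with p hp
  rw [Real.norm_of_nonneg (Real.exp_pos _).le]
  have h1 : t * (2 * p.2 * g p.1 - g p.1 ^ 2) ≤ 2 * t * B * |p.2| := by
    have h2 : p.2 * g p.1 ≤ |p.2| * B := (le_abs_self _).trans (by
      rw [abs_mul]; exact mul_le_mul_of_nonneg_left hp (abs_nonneg _))
    nlinarith [mul_le_mul_of_nonneg_left h2 ht, mul_nonneg ht (sq_nonneg (g p.1))]
  refine (Real.exp_le_exp.2 h1).trans ?_
  rcases abs_cases p.2 with ⟨h, -⟩ | ⟨h, -⟩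
  · rw [h]; exact le_add_of_nonneg_right (Real.exp_pos _).le
  · rw [h, show 2 * t * B * -p.2 = -(2 * t * B) * p.2 by ring]
    exact le_add_of_nonneg_left (Real.exp_pos _).le

/-- Exponential moment bound for the excess loss of one observation with Gaussian noise. -/
theorem integral_exp_excess_loss_le {g : α → ℝ} (hg : Measurable g) {B : ℝ}
    (hgB : ∀ᵐ x ∂μ, |g x| ≤ B) {t : ℝ} (ht : 0 ≤ t) (htν : 4 * t * ν ≤ 1)
    (htB : t * B ^ 2 ≤ 2) :
    ∫ p, Real.exp (t * (2 * p.2 * g p.1 - g p.1 ^ 2)) ∂(μ.prod (gaussianReal 0 ν))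
      ≤ Real.exp (-(t / 4) * ∫ x, g x ^ 2 ∂μ) := by
  have hsq : ∀ᵐ x ∂μ, g x ^ 2 ≤ B ^ 2 := by
    filter_upwards [hgB] with x hx
    rw [← sq_abs]
    exact pow_le_pow_left₀ (abs_nonneg _) hx 2
  have hint2 : Integrable (fun x => g x ^ 2) μ := by
    refine Integrable.of_bound (by fun_prop) (B ^ 2) ?_
    filter_upwards [hsq] with x hx
    rwa [Real.norm_of_nonneg (sq_nonneg _)]
  have hint := integrable_exp_excess_loss (ν := ν) hg hgB ht
  rw [integral_prod _ hint]
  have hinner : ∀ x, ∫ e, Real.exp (t * (2 * e * g x - g x ^ 2)) ∂(gaussianReal 0 ν)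
      = Real.exp (-(t * g x ^ 2) + ν * (2 * t * g x) ^ 2 / 2) := by
    intro x
    have hm := congrFun (mgf_id_gaussianReal (μ := 0) (v := ν)) (2 * t * g x)
    simp only [mgf, id, zero_mul, zero_add] at hm
    rw [Real.exp_add, ← hm, ← integral_const_mul]
    refine integral_congr_ae (ae_of_all _ fun e => ?_)
    simp only
    rw [← Real.exp_add]
    congr 1
    ring
  have hle : ∫ x, (∫ e, Real.exp (t * (2 * e * g x - g x ^ 2)) ∂(gaussianReal 0 ν)) ∂μ
      ≤ ∫ x, (1 - t / 4 * g x ^ 2) ∂μ := by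
    refine integral_mono_ae hint.integral_prod_left
      ((integrable_const _).sub (hint2.const_mul _)) ?_
    filter_upwards [hsq] with x hx
    simp only [hinner]
    -- Since `4 * t * ν ≤ 1`, the Gaussian term `2 * ν * t² * g²` uses up at most half of `t * g²`.
    have h1 : -(t * g x ^ 2) + ν * (2 * t * g x) ^ 2 / 2 ≤ -(t * g x ^ 2 / 2) := by
      nlinarith [mul_le_mul_of_nonneg_right htν (mul_nonneg ht (sq_nonneg (g x)))]
    refine (Real.exp_le_exp.2 h1).trans ((exp_neg_le_one_sub_half (by positivity) ?_).trans ?_)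
    · nlinarith [mul_le_mul_of_nonneg_left hx ht]
    · linarith
  refine hle.trans ?_
  rw [integral_sub (integrable_const _) (hint2.const_mul _), integral_const_mul]
  simp only [integral_const, probReal_univ, smul_eq_mul, mul_one]
  linarith [Real.add_one_le_exp (-(t / 4) * ∫ x, g x ^ 2 ∂μ)]

/-- Chernoff bound for the empirical excess loss of a fixed function. -/
theorem measureReal_excess_loss_le {X : ℕ → Ω → α} {ε : ℕ → Ω → ℝ}
    (hX_law : ∀ i, HasLaw (X i) μ P) (hε_law : ∀ i, HasLaw (ε i) (gaussianReal 0 ν) P)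
    (hXε_indep : ∀ i, IndepFun (X i) (ε i) P) (h_indep : iIndepFun (fun i ω => (X i ω, ε i ω)) P)
    {g : α → ℝ} (hg : Measurable g) {B : ℝ} (hgB : ∀ᵐ x ∂μ, |g x| ≤ B) {t : ℝ} (ht : 0 ≤ t)
    (htν : 4 * t * ν ≤ 1) (htB : t * B ^ 2 ≤ 2) (n : ℕ) (s : ℝ) :
    P.real {ω | -s ≤ ∑ i ∈ Finset.range n, (2 * ε i ω * g (X i ω) - g (X i ω) ^ 2)} ≤
      Real.exp (t * s) * Real.exp (-(t / 4) * ∫ x, g x ^ 2 ∂μ) ^ n := by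
  have hlaw : ∀ i, HasLaw (fun ω => (X i ω, ε i ω)) (μ.prod (gaussianReal 0 ν)) P :=
    fun i => (hXε_indep i).hasLaw_prod (hX_law i) (hε_law i)
  let W : α × ℝ → ℝ := fun p => 2 * p.2 * g p.1 - g p.1 ^ 2
  have hW : Measurable W := by fun_prop
  let Z : ℕ → Ω → ℝ := fun i ω => W (X i ω, ε i ω)
  have hZm : ∀ i, AEMeasurable (Z i) P := fun i => hW.comp_aemeasurable (hlaw i).aemeasurable
  have hZ_indep : iIndepFun Z P := h_indep.comp (fun _ => W) fun _ => hW
  have hmgf_eq : ∀ i, mgf (Z i) P t = ∫ p, Real.exp (t * W p) ∂(μ.prod (gaussianReal 0 ν)) :=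
    fun i => (hlaw i).integral_comp (f := fun p => Real.exp (t * W p)) (by fun_prop)
  have hpos : ∀ i, 0 < mgf (Z i) P t := fun i => by
    rw [hmgf_eq]
    exact integral_exp_pos (integrable_exp_excess_loss hg hgB ht)
  have hsum : mgf (∑ i ∈ Finset.range n, Z i) P t = ∏ i ∈ Finset.range n, mgf (Z i) P t :=
    hZ_indep.mgf_sum₀ hZm _
  have hint : Integrable (fun ω => Real.exp (t * (∑ i ∈ Finset.range n, Z i) ω)) P := by
    -- Without integrability the `mgf` would take its default value `0`, but it is a product of
    -- positive factors.
    by_contra hnot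
    exact (Finset.prod_pos fun i _ => hpos i).ne' (hsum.symm.trans (mgf_undef hnot))
  have key := measure_ge_le_exp_mul_mgf (X := ∑ i ∈ Finset.range n, Z i) (-s) ht hint
  simp only [Finset.sum_apply] at key
  refine key.trans ?_
  rw [hsum, show -t * -s = t * s by ring]
  refine mul_le_mul_of_nonneg_left ?_ (Real.exp_pos _).le
  calc ∏ i ∈ Finset.range n, mgf (Z i) P t
      ≤ ∏ _i ∈ Finset.range n, Real.exp (-(t / 4) * ∫ x, g x ^ 2 ∂μ) :=
        Finset.prod_le_prod (fun i _ => (hpos i).le) fun i _ => by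
          rw [hmgf_eq]
          exact integral_exp_excess_loss_le hg hgB ht htν htB
    _ = _ := by simp

/-- The averages of identically distributed Gaussian variables are uniformly tight. -/
theorem measure_sum_abs_gaussian_gt_le {ε : ℕ → Ω → ℝ}
    (hε_law : ∀ i, HasLaw (ε i) (gaussianReal 0 ν) P) {K : ℝ} (hK : 0 < K) {n : ℕ} (hn : 1 ≤ n) :
    P {ω | K * n < ∑ i ∈ Finset.range n, |ε i ω|} ≤
      ENNReal.ofReal ((∫ e, |e| ∂(gaussianReal 0 ν)) / K) := by
  have habs : Integrable (fun e : ℝ => |e|) (gaussianReal 0 ν) :=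
    (memLp_id_gaussianReal 1).integrable le_rfl |>.abs
  have hint : ∀ i, Integrable (fun ω => |ε i ω|) P := fun i => by
    have := (hε_law i).map_eq ▸ habs
    exact (integrable_map_measure (by fun_prop) (hε_law i).aemeasurable).1 this
  have hval : ∀ i, ∫ ω, |ε i ω| ∂P = ∫ e, |e| ∂(gaussianReal 0 ν) := fun i =>
    (hε_law i).integral_comp (f := fun e => |e|) (by fun_prop)
  have hn' : (0 : ℝ) < n := by exact_mod_cast hn
  have hmarkov := mul_meas_ge_le_integral_of_nonneg (μ := P)
    (f := fun ω => ∑ i ∈ Finset.range n, |ε i ω|)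
    (ae_of_all _ fun ω => Finset.sum_nonneg fun i _ => abs_nonneg _)
    (integrable_finsetSum _ fun i _ => hint i) (K * n)
  rw [integral_finsetSum _ fun i _ => hint i] at hmarkov
  simp only [hval, Finset.sum_const, Finset.card_range, nsmul_eq_mul] at hmarkov
  calc P {ω | K * n < ∑ i ∈ Finset.range n, |ε i ω|}
      ≤ P {ω | K * n ≤ ∑ i ∈ Finset.range n, |ε i ω|} :=
        measure_mono (Set.ofPred_subset_ofPred.2 fun ω hω => hω.le)
    _ = ENNReal.ofReal (P.real {ω | K * n ≤ ∑ i ∈ Finset.range n, |ε i ω|}) := by simp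
    _ ≤ _ := by
      refine ENNReal.ofReal_le_ofReal ((le_div_iff₀ hK).2 ?_)
      refine le_of_mul_le_mul_left ?_ hn'
      linarith

end ExcessLoss

/-! ### Rate of least squares over classes with polynomial covering numbers -/

theorem eLpNorm_two_eq_ofReal_sqrt {α : Type*} [MeasurableSpace α] {μ : Measure α} {g : α → ℝ}
    (hg : MemLp g 2 μ) :
    eLpNorm g 2 μ = ENNReal.ofReal (Real.sqrt (∫ x, g x ^ 2 ∂μ)) := by
  rw [hg.eLpNorm_eq_integral_rpow_norm (by simp) (by simp), Real.sqrt_eq_rpow]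
  simp

/-- The empirical excess loss of a minimizer is nonnegative, and it is stable under uniformly small
perturbations of the minimizer. -/
theorem neg_le_sum_excess_loss_of_isMin {n : ℕ} (hn : 1 ≤ n) {f f₀ g : ℕ → ℝ} {e : ℕ → ℝ} {B K : ℝ}
    (hf : ∀ i, |f i| ≤ B) (hf₀ : ∀ i, |f₀ i| ≤ B) (hg : ∀ i, |g i| ≤ B)
    (hfg : ∀ i, |f i - g i| ≤ 1 / n) (he : ∑ i ∈ Finset.range n, |e i| ≤ K * n)
    (hmin : ∑ i ∈ Finset.range n, (f₀ i + e i - f i) ^ 2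
      ≤ ∑ i ∈ Finset.range n, (f₀ i + e i - f₀ i) ^ 2) :
    -(2 * K + 4 * B) ≤ ∑ i ∈ Finset.range n, (2 * e i * (g i - f₀ i) - (g i - f₀ i) ^ 2) := by
  have hn' : (0 : ℝ) < n := by exact_mod_cast hn
  -- The difference of squares is the excess loss at `f`; replacing `f` by `g` changes it by `2 * e
  -- * (g - f) - (g - f) * (g + f - 2 * f₀)`.
  have hterm : ∀ i, (f₀ i + e i - f₀ i) ^ 2 - (f₀ i + e i - f i) ^ 2
      - (2 / n * |e i| + 4 * B / n) ≤ 2 * e i * (g i - f₀ i) - (g i - f₀ i) ^ 2 := by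
    intro i
    have h1 : e i * (f i - g i) ≤ |e i| * (1 / n) := (le_abs_self _).trans (by
      rw [abs_mul]; exact mul_le_mul_of_nonneg_left (hfg i) (abs_nonneg _))
    have h2 : (g i - f i) * (g i + f i - 2 * f₀ i) ≤ 1 / n * (4 * B) := (le_abs_self _).trans (by
      rw [abs_mul]
      refine mul_le_mul (by rw [abs_sub_comm]; exact hfg i) ?_ (abs_nonneg _) (by positivity)
      have := abs_le.1 (hf i)
      have := abs_le.1 (hf₀ i)
      have := abs_le.1 (hg i)
      exact abs_le.2 ⟨by linarith, by linarith⟩)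
    have h3 : 2 / (n : ℝ) * |e i| + 4 * B / n = 2 * (|e i| * (1 / n)) + 1 / n * (4 * B) := by ring
    rw [h3]
    nlinarith
  have hsum := Finset.sum_le_sum fun i (_ : i ∈ Finset.range n) => hterm i
  rw [Finset.sum_sub_distrib, Finset.sum_sub_distrib, Finset.sum_add_distrib, ← Finset.mul_sum,
    Finset.sum_const, Finset.card_range, nsmul_eq_mul] at hsum
  have h4 : 2 / (n : ℝ) * ∑ i ∈ Finset.range n, |e i| ≤ 2 * K := by
    calc _ ≤ 2 / (n : ℝ) * (K * n) := mul_le_mul_of_nonneg_left he (by positivity)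
      _ = 2 * K := by field_simp
  have h5 : (n : ℝ) * (4 * B / n) = 4 * B := by field_simp
  linarith

section LeastSquares

variable {α Ω : Type*} [MeasurableSpace α] [MeasurableSpace Ω] {μ : Measure α}
  [IsProbabilityMeasure μ] {P : Measure Ω} [IsProbabilityMeasure P] {ν : ℝ≥0}

/-- Rate of convergence of least squares estimators over a uniformly bounded class of regression
functions whose sup-norm covering numbers grow polynomially. -/
theorem isBigOInProbability_leastSquares {S : Set α} (hS : ∀ᵐ x ∂μ, x ∈ S) {F : Set (α → ℝ)}
    (hF_meas : ∀ f ∈ F, Measurable f) {B : ℝ} (hF_bdd : ∀ f ∈ F, ∀ x ∈ S, |f x| ≤ B)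
    (hF_cover : ∃ A a : ℕ, ∀ n : ℕ, 1 ≤ n → ∃ T : Finset (α → ℝ), ↑T ⊆ F ∧ T.card ≤ A * n ^ a ∧
      ∀ f ∈ F, ∃ g ∈ T, ∀ x ∈ S, |f x - g x| ≤ 1 / n)
    {f₀ : α → ℝ} (hf₀ : f₀ ∈ F) {X : ℕ → Ω → α} {ε : ℕ → Ω → ℝ}
    (hX_law : ∀ i, HasLaw (X i) μ P) (hε_law : ∀ i, HasLaw (ε i) (gaussianReal 0 ν) P)
    (hXε_indep : ∀ i, IndepFun (X i) (ε i) P) (h_indep : iIndepFun (fun i ω => (X i ω, ε i ω)) P)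
    {fhat : ℕ → Ω → α → ℝ}
    (hfhat : ∀ n, ∀ᵐ ω ∂P, fhat n ω ∈ F ∧
      ∑ i ∈ Finset.range n, (f₀ (X i ω) + ε i ω - fhat n ω (X i ω)) ^ 2
        ≤ ∑ i ∈ Finset.range n, (f₀ (X i ω) + ε i ω - f₀ (X i ω)) ^ 2) :
    IsBigOInProbability P (fun n ω => eLpNorm (fun x => fhat n ω x - f₀ x) 2 μ)
      (fun n => Real.sqrt (Real.log n / n)) := by
  classical
  intro δ hδ
  obtain ⟨A, a, hcov⟩ := hF_cover
  obtain ⟨t, ht, htν, htB⟩ : ∃ t : ℝ, 0 < t ∧ 4 * t * ν ≤ 1 ∧ t * (2 * B) ^ 2 ≤ 2 := by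
    have h0 : (0 : ℝ) < 4 * ν + 4 * B ^ 2 + 1 := by positivity
    refine ⟨1 / (4 * ν + 4 * B ^ 2 + 1), by positivity, ?_, ?_⟩
    · rw [mul_one_div, div_mul_eq_mul_div, div_le_one h0]
      linarith [sq_nonneg B]
    · rw [one_div_mul_eq_div, div_le_iff₀ h0]
      nlinarith [sq_nonneg B, ν.coe_nonneg]
  obtain ⟨K, hK, hKδ⟩ : ∃ K : ℝ, 0 < K ∧ (∫ e, |e| ∂(gaussianReal 0 ν)) / K ≤ δ / 2 := by
    have h0 : 0 ≤ ∫ e, |e| ∂(gaussianReal 0 ν) := integral_nonneg fun e => abs_nonneg e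
    refine ⟨2 * (∫ e, |e| ∂(gaussianReal 0 ν) + 1) / δ, by positivity, ?_⟩
    rw [div_le_iff₀ (by positivity)]
    field_simp
    linarith
  -- This makes the Chernoff bound at distance `D * b` of order `n ^ -(a + 1)`, one power better
  -- than the net size.
  obtain ⟨D, hD, hDt⟩ : ∃ D : ℝ, 0 < D ∧ (a : ℝ) + 1 ≤ t / 4 * D ^ 2 := by
    refine ⟨4 * (a + 1) / t + 1, by positivity, ?_⟩
    have h0 : (0 : ℝ) ≤ 4 * (a + 1) / t := by positivity
    calc (a : ℝ) + 1 = t / 4 * (4 * (a + 1) / t) := by field_simp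
      _ ≤ t / 4 * (4 * (a + 1) / t + 1) ^ 2 :=
          mul_le_mul_of_nonneg_left (by nlinarith) (by positivity)
  set s : ℝ := 2 * K + 4 * B with hs
  -- `D` is for the net point, the extra `1` for the approximation error `1 / n ≤ b`.
  refine ⟨D + 1, by positivity, ?_⟩
  have hlarge : ∀ᶠ n : ℕ in atTop, A * Real.exp (t * s) / (δ / 2) ≤ (n : ℝ) :=
    tendsto_natCast_atTop_atTop.eventually_ge_atTop _
  filter_upwards [hlarge, eventually_ge_atTop 3] with n hnA hn3
  have hn1 : 1 ≤ n := by omega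
  have hn' : (0 : ℝ) < n := by exact_mod_cast hn1
  have hlog : 1 ≤ Real.log n := by
    rw [Real.le_log_iff_exp_le hn']
    have : (3 : ℝ) ≤ n := by exact_mod_cast hn3
    linarith [Real.exp_one_lt_d9]
  set b : ℝ := Real.sqrt (Real.log n / n) with hb
  have hb_sq : b ^ 2 = Real.log n / n := Real.sq_sqrt (by positivity)
  have hb_ge : 1 / (n : ℝ) ≤ b := by
    refine Real.le_sqrt_of_sq_le ?_
    rw [div_pow, one_pow, sq, div_le_div_iff₀ (by positivity) hn']
    nlinarith [(by exact_mod_cast hn1 : (1 : ℝ) ≤ n)]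
  obtain ⟨T, hTF, hTcard, hT⟩ := hcov n hn1
  -- The far net points are chosen independently of the sample, so the bound for a fixed function
  -- applies to each.
  set T' := T.filter fun g => ENNReal.ofReal (D * b) < eLpNorm (fun x => g x - f₀ x) 2 μ with hT'
  have hdiff_bdd : ∀ g ∈ F, ∀ᵐ x ∂μ, |g x - f₀ x| ≤ 2 * B := fun g hg => by
    filter_upwards [hS] with x hx
    exact (abs_sub _ _).trans (by linarith [hF_bdd g hg x hx, hF_bdd f₀ hf₀ x hx])
  have hdiff_meas : ∀ g ∈ F, Measurable fun x => g x - f₀ x := fun g hg =>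
    (hF_meas g hg).sub (hF_meas f₀ hf₀)
  have hevent : ∀ g ∈ T', P {ω | -s ≤ ∑ i ∈ Finset.range n,
      (2 * ε i ω * (g (X i ω) - f₀ (X i ω)) - (g (X i ω) - f₀ (X i ω)) ^ 2)} ≤
      ENNReal.ofReal (Real.exp (t * s) / (n : ℝ) ^ (a + 1)) := by
    intro g hg
    obtain ⟨hgT, hg_lt⟩ := Finset.mem_filter.1 hg
    have hgF : g ∈ F := hTF hgT
    have hmem : MemLp (fun x => g x - f₀ x) 2 μ :=
      MemLp.of_bound (hdiff_meas g hgF).aestronglyMeasurable (2 * B) (hdiff_bdd g hgF)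
    rw [eLpNorm_two_eq_ofReal_sqrt hmem] at hg_lt
    have hint : D ^ 2 * (Real.log n / n) ≤ ∫ x, (g x - f₀ x) ^ 2 ∂μ := by
      rw [← hb_sq, ← mul_pow]
      exact (Real.le_sqrt' (by positivity)).1 (ENNReal.ofReal_lt_ofReal_iff'.1 hg_lt).1.le
    have hchern := measureReal_excess_loss_le hX_law hε_law hXε_indep h_indep (hdiff_meas g hgF)
      (hdiff_bdd g hgF) ht.le htν htB n s
    rw [← ofReal_measureReal]
    refine ENNReal.ofReal_le_ofReal (hchern.trans ?_)
    rw [div_eq_mul_inv]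
    refine mul_le_mul_of_nonneg_left ?_ (Real.exp_pos _).le
    rw [← Real.exp_nat_mul, ← Real.exp_log (pow_pos hn' (a + 1)), ← Real.exp_neg, Real.log_pow]
    refine Real.exp_le_exp.2 ?_
    have h1 : t / 4 * (D ^ 2 * (Real.log n / n)) * n ≤ t / 4 * (∫ x, (g x - f₀ x) ^ 2 ∂μ) * n := by
      gcongr
    have h2 : t / 4 * (D ^ 2 * (Real.log n / n)) * n = t / 4 * D ^ 2 * Real.log n := by
      field_simp
    have h3 : ((a : ℝ) + 1) * Real.log n ≤ t / 4 * D ^ 2 * Real.log n :=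
      mul_le_mul_of_nonneg_right hDt (by linarith)
    push_cast
    linarith
  have hX_mem : ∀ᵐ ω ∂P, ∀ i, X i ω ∈ S := ae_all_iff.2 fun i =>
    ae_of_ae_map (hX_law i).aemeasurable ((hX_law i).map_eq.symm ▸ hS)
  have hsub : {ω | ENNReal.ofReal ((D + 1) * b) < eLpNorm (fun x => fhat n ω x - f₀ x) 2 μ} ≤ᵐ[P]
      ({ω | K * n < ∑ i ∈ Finset.range n, |ε i ω|} ∪ ⋃ g ∈ T', {ω | -s ≤ ∑ i ∈ Finset.range n,
        (2 * ε i ω * (g (X i ω) - f₀ (X i ω)) - (g (X i ω) - f₀ (X i ω)) ^ 2)} : Set Ω) := by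
    filter_upwards [hX_mem, hfhat n] with ω hXω hω hlt
    obtain ⟨hfF, hmin⟩ := hω
    by_cases hKω : K * n < ∑ i ∈ Finset.range n, |ε i ω|
    · exact Or.inl hKω
    refine Or.inr ?_
    obtain ⟨g, hgT, hfg⟩ := hT _ hfF
    have hgF : g ∈ F := hTF hgT
    have hclose : eLpNorm (fun x => fhat n ω x - g x) 2 μ ≤ ENNReal.ofReal b := by
      have := eLpNorm_le_of_ae_bound (p := 2) (μ := μ) (f := fun x => fhat n ω x - g x)
        (C := 1 / (n : ℝ)) (by filter_upwards [hS] with x hx using hfg x hx)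
      simp only [measure_univ, ENNReal.one_rpow, one_mul] at this
      exact this.trans (ENNReal.ofReal_le_ofReal hb_ge)
    have hg_far : ENNReal.ofReal (D * b) < eLpNorm (fun x => g x - f₀ x) 2 μ := by
      by_contra! hle
      refine absurd (show ENNReal.ofReal ((D + 1) * b) < _ from hlt) (not_lt.2 ?_)
      have hadd := eLpNorm_add_le (μ := μ) (p := 2)
        (((hF_meas _ hfF).sub (hF_meas g hgF)).aestronglyMeasurable)
        ((hdiff_meas g hgF).aestronglyMeasurable) (by norm_num)
      have heq : (fun x => fhat n ω x - f₀ x) =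
          (fhat n ω - g) + fun x => g x - f₀ x := by
        ext x
        simp
      rw [heq, add_mul, one_mul, add_comm (D * b),
        ENNReal.ofReal_add (Real.sqrt_nonneg _) (by positivity)]
      exact hadd.trans (add_le_add hclose hle)
    refine Set.mem_iUnion₂.2 ⟨g, Finset.mem_filter.2 ⟨hgT, hg_far⟩, ?_⟩
    exact neg_le_sum_excess_loss_of_isMin hn1 (fun i => hF_bdd _ hfF _ (hXω i))
      (fun i => hF_bdd _ hf₀ _ (hXω i)) (fun i => hF_bdd _ hgF _ (hXω i))
      (fun i => hfg _ (hXω i)) (not_lt.1 hKω) hmin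
  refine (measure_mono_ae hsub).trans ((measure_union_le _ _).trans ?_)
  rw [← add_halves δ, ENNReal.ofReal_add (by positivity) (by positivity)]
  refine add_le_add ((measure_sum_abs_gaussian_gt_le hε_law hK hn1).trans
    (ENNReal.ofReal_le_ofReal hKδ)) ?_
  refine (measure_biUnion_finset_le _ _).trans ((Finset.sum_le_sum hevent).trans ?_)
  rw [Finset.sum_const, ← ENNReal.ofReal_nsmul, nsmul_eq_mul]
  refine ENNReal.ofReal_le_ofReal ?_
  have hcard : (T'.card : ℝ) ≤ A * (n : ℝ) ^ a := by
    exact_mod_cast (Finset.card_filter_le _ _).trans hTcard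
  calc (T'.card : ℝ) * (Real.exp (t * s) / (n : ℝ) ^ (a + 1))
      ≤ A * (n : ℝ) ^ a * (Real.exp (t * s) / (n : ℝ) ^ (a + 1)) := by gcongr
    _ = A * Real.exp (t * s) / n := by field_simp; ring
    _ ≤ δ / 2 := by
        rw [div_le_iff₀ hn']
        rw [div_le_iff₀ (by positivity)] at hnA
        linarith

end LeastSquares

/-! ### Application to the mixture of experts -/

theorem theorem2p1
    {d q : ℕ}
    -- the parameter space is compact, the input space is bounded
    (Θ : Set (MoEParam d q)) (hΘ : IsCompact Θ)
    (𝒳 : Set (EuclideanSpace ℝ (Fin d))) (h𝒳 : Bornology.IsBounded 𝒳)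
    -- the input distribution
    (μ : Measure (EuclideanSpace ℝ (Fin d))) [IsProbabilityMeasure μ] (hμ : ∀ᵐ x ∂μ, x ∈ 𝒳)
    -- the expert function: measurable in the input, bounded, Lipschitz in its parameter
    (h : EuclideanSpace ℝ (Fin d) → EuclideanSpace ℝ (Fin q) → ℝ)
    (h_meas : ∀ θ ∈ Θ, Measurable fun x => h x θ.2.2)
    (h_bdd : ∃ M : ℝ, ∀ x ∈ 𝒳, ∀ θ ∈ Θ, |h x θ.2.2| ≤ M)
    (h_lip : ∃ L : ℝ, ∀ x ∈ 𝒳, ∀ θ ∈ Θ, ∀ θ' ∈ Θ,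
      |h x θ.2.2 - h x θ'.2.2| ≤ L * ‖θ.2.2 - θ'.2.2‖)
    -- the true parameters `(β*₀ᵢ, β*₁ᵢ, η*ᵢ)` of the `kstar` true experts
    {kstar k : ℕ} (hk : kstar ≤ k)
    (θstar : Fin kstar → MoEParam d q) (hθstar : ∀ i, θstar i ∈ Θ)
    (hη_inj : Function.Injective fun i => (θstar i).2.2)
    (h_last : ∀ i : Fin kstar, (i : ℕ) + 1 = kstar → (θstar i).1 = 0 ∧ (θstar i).2.1 = 0)
    (h_gate : ∃ i, (θstar i).2.1 ≠ 0)
    -- the i.i.d. sample from the regression model with Gaussian noise of variance `ν`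
    {Ω : Type*} [MeasurableSpace Ω] (P : Measure Ω) [IsProbabilityMeasure P]
    (ν : ℝ≥0) (X : ℕ → Ω → EuclideanSpace ℝ (Fin d)) (ε Y : ℕ → Ω → ℝ)
    (hX_law : ∀ i, HasLaw (X i) μ P)
    (hε_law : ∀ i, HasLaw (ε i) (gaussianReal 0 ν) P)
    (hXε_indep : ∀ i, IndepFun (X i) (ε i) P)
    (h_indep : iIndepFun (fun i ω => (X i ω, ε i ω)) P)
    (hY : ∀ i ω, Y i ω = moeRegression h (mixingMeasure θstar) (X i ω) + ε i ω)
    -- the least squares estimator based on the first `n` observations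
    (Ghat : ℕ → Ω → Measure (MoEAtom d q))
    (hGhat : ∀ n, ∀ᵐ ω ∂P, IsLeastSquaresEstimator h k Θ
      (fun i : Fin n => X i ω) (fun i : Fin n => Y i ω) (Ghat n ω)) :
    IsBigOInProbability P
      (fun n ω => eLpNorm
        (fun x => moeRegression h (Ghat n ω) x - moeRegression h (mixingMeasure θstar) x) 2 μ)
      (fun n => Real.sqrt (Real.log n / n)) := by

  -- An index exists, so `1 ≤ kstar`: the true mixing measure is an admissible competitor.
  obtain ⟨i₀, -⟩ := h_gate
  have hkstar : 1 ≤ kstar := Nat.one_le_of_lt i₀.isLt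
  have hmem : mixingMeasure θstar ∈ mixingMeasures k Θ := ⟨kstar, hkstar, hk, θstar, hθstar, rfl⟩
  obtain ⟨M, hM⟩ := h_bdd
  refine isBigOInProbability_leastSquares hμ (F := moeRegression h '' mixingMeasures k Θ) (B := M)
    ?_ ?_ (exists_finset_cover_moeRegression k hΘ h𝒳 ⟨M, hM⟩ h_lip) ⟨_, hmem, rfl⟩ hX_law hε_law
    hXε_indep h_indep (fhat := fun n ω => moeRegression h (Ghat n ω)) fun n => ?_
  · rintro _ ⟨_, ⟨m, -, -, θ, hθ, rfl⟩, rfl⟩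
    exact measurable_moeRegression h_meas hθ
  · rintro _ ⟨_, ⟨m, hm, -, θ, hθ, rfl⟩, rfl⟩ x hx
    exact abs_moeRegression_le hm (hM x hx) hθ
  · filter_upwards [hGhat n] with ω hω
    refine ⟨⟨_, hω.1, rfl⟩, ?_⟩
    have hmin := isMinOn_iff.1 hω.2 _ hmem
    simp only [hY] at hmin
    simpa only [Finset.sum_range] using hmin
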